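/- All graphs are finite and simple. For a graph $G$ let $V(G)$, $E(G)$ be its vertex and edge sets, $\Delta(G)$ and $\delta(G)$ its maximum and minimum degree, $V_d(G)$ the set of its vertices of degree $d$, $\chi'(G)$ its chromatic index (the least number of colours in a proper edge-colouring), and $\alpha(G)$ the maximum cardinality of an independent set of vertices; the independence ratio of $G$ is $\iota(G)=\alpha(G)/|V(G)|$. For $k\ge 2$, a graph $G$ is $k$-critical if $\Delta(G)=k$, $\chi'(G)=k+1$, and $\chi'(G-e)=k$ for every $e\in E(G)$. For integers $k\ge 2$ and $t\ge 0$ let $\mathcal C(k,t)$ be the set of all $k$-critical graphs $G$ such that $\delta(G)\ge k-1$ and there is a family of paths in $G$ that contains, for every $v\in V_{k-1}(G)$, $k-1$ paths $p_1(v),\dots,p_{k-1}(v)$ with initial vertex $v$, such that for all $v\in V_{k-1}(G)$ and all $i,j\in\{1,\dots,k-1\}$: (a) $V(p_i(v))\cap V_{k-1}(G)=\{v\}$; (b) $|V(p_i(v))|\ge 2t(k-1)+2$; (c) if $i\ne j$, then $V(p_i(v))\cap V(p_j(v))=\{v\}$; (d) if $w\in V_{k-1}(G)$ and $w\neq v$,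 then $V(p_i(v))\cap V(p_j(w))=\emptyset$. Let $\iota(k,t)=\sup\{\iota(G): G\in\mathcal C(k,t)\}$. **Theorem.** For every integer $k\ge 2$, $\lim_{t\to\infty}\iota(k,t)=\tfrac12$. -/

import Mathlib

open Filter Topology

namespace CriticalGraph

/-- The chromatic index `χ'(G)`: the least number of colours in a proper edge-colouring of `G`,
i.e. in a proper vertex-colouring of its line graph. -/
noncomputable def chromaticIndex {V : Type*} (G : SimpleGraph V) : ℕ∞ :=
  G.lineGraph.chromaticNumber

open Classical in
/-- `G` is `k`-critical: `Δ(G) = k`, `χ'(G) = k + 1`, and `χ'(G - e) = k` for every edge `e`. -/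
def IsCritical {V : Type*} [Fintype V] (k : ℕ) (G : SimpleGraph V) : Prop :=
  G.maxDegree = k ∧ chromaticIndex G = (k : ℕ∞) + 1 ∧
    ∀ e ∈ G.edgeSet, chromaticIndex (G.deleteEdges {e}) = (k : ℕ∞)

open Classical in
/-- The set `V_d(G)` of vertices of degree `d`. -/
def degreeSet {V : Type*} [Fintype V] (G : SimpleGraph V) (d : ℕ) : Set V :=
  {v | G.degree v = d}

/-- The vertex set of a walk. -/
def walkVerts {V : Type*} {G : SimpleGraph V} {v w : V} (p : G.Walk v w) : Set V :=
  {x | x ∈ p.support}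

/-- Every vertex `v` of degree `k - 1` is the initial vertex of `k - 1` distinguished paths
`p v 0, …, p v (k - 2)`, the path `p v i` ending at `z v i`. The family `p` is indexed by all
vertices, but only its members starting at vertices of degree `k - 1` are constrained. -/
def HasDistinguishedPaths {V : Type*} [Fintype V] (k t : ℕ) (G : SimpleGraph V) : Prop :=
  ∃ (z : V → Fin (k - 1) → V) (p : ∀ (v : V) (i : Fin (k - 1)), G.Walk v (z v i)),
    ∀ v ∈ degreeSet G (k - 1),
      (∀ i, (p v i).IsPath) ∧
      (∀ i, walkVerts (p v i) ∩ degreeSet G (k - 1) = {v}) ∧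
      (∀ i, 2 * t * (k - 1) + 2 ≤ (walkVerts (p v i)).ncard) ∧
      (∀ i j, i ≠ j → walkVerts (p v i) ∩ walkVerts (p v j) = {v}) ∧
      (∀ w ∈ degreeSet G (k - 1), w ≠ v →
        ∀ i j, walkVerts (p v i) ∩ walkVerts (p w j) = ∅)

open Classical in
/-- Membership of `G` in the class `C(k, t)` (for `k ≥ 2`). -/
def InClass {V : Type*} [Fintype V] (k t : ℕ) (G : SimpleGraph V) : Prop :=
  IsCritical k G ∧ k - 1 ≤ G.minDegree ∧ HasDistinguishedPaths k t G

/-- The independence ratio `ι(G) = α(G) / |V(G)|`. -/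
noncomputable def indepRatio {V : Type*} [Fintype V] (G : SimpleGraph V) : ℝ :=
  (G.indepNum : ℝ) / (Fintype.card V : ℝ)

/-- `ι(k, t) = sup {ι(G) : G ∈ C(k, t)}`. Every finite graph is isomorphic to one whose vertex type
lives in `Type`, so it is enough to take these. -/
noncomputable def iota (k t : ℕ) : ℝ :=
  sSup {r : ℝ | ∃ (V : Type) (_ : Fintype V) (G : SimpleGraph V),
    InClass k t G ∧ r = indepRatio G}

end CriticalGraph

/-! Put k = m + 1. Both bounds on ι(k,t) tend to 1/2. Upper bound: let d be the number of vertices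
of degree m and n = |V(G)|. Counting the edges that leave a maximum independent set gives 2kα ≤ kn +
d (`indepNum_mul_le`). One path from each vertex of degree m already gives disjoint sets of at least
t + 1 vertices, so d(t + 1) ≤ n (`card_degreeSet_mul_le`). Lower bound: the Meredith extension
replaces each vertex by a blob K_{m+1,m} and attaches the old edges at distinct slots, the vertices
of the larger side. In a colouring of a blob with m + 1 colours, each colour is missing at exactly
one slot, and every bijection from slots to missing colours occurs. Hence a blob behaves like a
vertex for edge-colouring, and criticality survives (`isCritical_meredith`). The extension also
preserves n - 2α ≤ 1 (`card_le_indepNum_blowUp`) and triples the lengths of the distinguished paths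
(`HasLongPaths.meredith`). Iterating it from K_{m+1,m} plus an edge joining two slots gives members
of every C(k,t) with n ≤ 2α + 1 and n arbitrarily large. -/

namespace CriticalGraph

/-! ### Edge-colourings and criticality -/

/-- `G` has a proper edge-colouring with `n` colours; `C v w` is the colour of the edge `vw`. -/
def EdgeColorable {V : Type*} (G : SimpleGraph V) (n : ℕ) : Prop :=
  ∃ C : V → V → Fin n, (∀ v w, G.Adj v w → C v w = C w v) ∧
    ∀ v w w', G.Adj v w → G.Adj v w' → C v w = C v w' → w = w'

theorem EdgeColorable.succ_of_deleteEdges {V : Type*} {G : SimpleGraph V} {n : ℕ} {x y : V}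
    (hG : EdgeColorable (G.deleteEdges {s(x, y)}) n) : EdgeColorable G (n + 1) := by
  classical
  obtain ⟨C, hs, hp⟩ := hG
  simp only [SimpleGraph.deleteEdges_adj, Set.mem_singleton_iff] at hs hp
  refine ⟨fun v w => if s(v, w) = s(x, y) then Fin.last n else (C v w).castSucc, ?_, ?_⟩
  · intro v w hvw
    by_cases h : s(v, w) = s(x, y)
    · simp [h, Sym2.eq_swap (a := w) (b := v)]
    · simp only [h, Sym2.eq_swap (a := w) (b := v), if_false]
      rw [hs v w ⟨hvw, h⟩]
  · intro v w w' h1 h2 h3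
    by_cases h : s(v, w) = s(x, y) <;> by_cases h' : s(v, w') = s(x, y)
    · exact Sym2.congr_right.1 (h.trans h'.symm)
    · simp only [h, h', if_true, if_false] at h3
      exact absurd h3.symm (Fin.castSucc_lt_last _).ne
    · simp only [h, h', if_true, if_false] at h3
      exact absurd h3 (Fin.castSucc_lt_last _).ne
    · simp only [h, h', if_false] at h3
      exact hp v w w' ⟨h1, h⟩ ⟨h2, h'⟩ (Fin.castSucc_injective n h3)

/-- The condition `n ≠ 0` is needed because colourings here are total on pairs: non-adjacent pairs
need a default colour. -/
theorem chromaticIndex_le_iff {V : Type*} {G : SimpleGraph V} {n : ℕ} (hn : n ≠ 0) :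
    chromaticIndex G ≤ n ↔ EdgeColorable G n := by
  rw [chromaticIndex, SimpleGraph.chromaticNumber_le_iff_colorable]
  constructor
  · rintro ⟨C⟩
    classical
    have : NeZero n := ⟨hn⟩
    have key : ∀ {v w w'} (h : G.Adj v w) (h' : G.Adj v w'), w ≠ w' →
        C ⟨s(v, w), h⟩ ≠ C ⟨s(v, w'), h'⟩ := by
      intro v w w' h h' hne
      apply C.valid
      refine ⟨fun he => hne ?_, v, ?_⟩
      · exact Sym2.congr_right.1 (congrArg Subtype.val he)
      · simp
    refine ⟨fun v w => if h : G.Adj v w then C ⟨s(v, w), h⟩ else 0, ?_, ?_⟩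
    · intro v w h
      simp only [h, h.symm, dif_pos]
      congr 2
      exact Sym2.eq_swap
    · intro v w w' h h' he
      simp only [h, h', dif_pos] at he
      by_contra hne
      exact key h h' hne he
  · rintro ⟨C, hs, hp⟩
    refine ⟨SimpleGraph.Coloring.mk (fun e => C (Quot.out e.1).1 (Quot.out e.1).2) ?_⟩
    have key : ∀ (e : G.edgeSet) (v : V), v ∈ e.1 → ∃ w, ∃ h : G.Adj v w, e = ⟨s(v, w), h⟩ ∧
        C (Quot.out e.1).1 (Quot.out e.1).2 = C v w := by
      rintro ⟨e, he⟩ v hv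
      have hout : s((Quot.out e).1, (Quot.out e).2) = e := Quot.out_eq e
      generalize hab : Quot.out e = ab at hout
      obtain ⟨a, b⟩ := ab
      subst hout
      simp only [SimpleGraph.mem_edgeSet] at he
      simp only [Sym2.mem_iff] at hv
      rcases hv with rfl | rfl
      · exact ⟨b, he, rfl, rfl⟩
      · exact ⟨a, he.symm, Subtype.ext Sym2.eq_swap, hs _ _ he⟩
    rintro e f ⟨hne, v, hve, hvf⟩ he
    obtain ⟨w, hw, rfl, h1⟩ := key e v hve
    obtain ⟨w', hw', rfl, h2⟩ := key f v hvf
    rw [h1, h2] at he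
    obtain rfl := hp v w w' hw hw' he
    exact hne rfl

open Classical in
-- Restoring a deleted edge costs at most one new colour, so the two equalities for the chromatic
-- index follow from one-sided bounds.
theorem isCritical_iff {V : Type*} [Fintype V] {k : ℕ} (hk : 2 ≤ k) {G : SimpleGraph V} :
    IsCritical k G ↔ G.maxDegree = k ∧ ¬ EdgeColorable G k ∧
      ∀ x y, G.Adj x y → EdgeColorable (G.deleteEdges {s(x, y)}) k := by
  rw [IsCritical]
  refine and_congr_right fun _ => ⟨?_, ?_⟩
  · rintro ⟨h1, h2⟩
    refine ⟨?_, fun x y hxy => ?_⟩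
    · rw [← chromaticIndex_le_iff (by lia), h1]
      exact_mod_cast (Nat.lt_succ_self k).not_ge
    · rw [← chromaticIndex_le_iff (by lia)]
      exact (h2 _ hxy).le
  · rintro ⟨h1, h2⟩
    have hle : ∀ n : ℕ, ∀ a : ℕ∞, ¬ a ≤ n → (n : ℕ∞) + 1 ≤ a := fun n a h =>
      Order.add_one_le_of_lt (not_le.1 h)
    refine ⟨le_antisymm ?_ ?_, ?_⟩
    · have : ∃ x y, G.Adj x y := by
        by_contra! h
        exact h1 ⟨fun _ _ => ⟨0, by lia⟩, fun _ _ _ => rfl, fun v w _ hw => absurd hw (h v w)⟩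
      obtain ⟨x, y, hxy⟩ := this
      have := (chromaticIndex_le_iff (by lia)).2 (h2 x y hxy).succ_of_deleteEdges
      exact_mod_cast this
    · exact hle _ _ fun h => h1 ((chromaticIndex_le_iff (by lia)).1 h)
    · intro e he
      induction e with | _ x y
      refine le_antisymm ((chromaticIndex_le_iff (by lia)).2 (h2 x y he)) ?_
      obtain ⟨n, rfl⟩ : ∃ n, k = n + 1 := ⟨k - 1, by lia⟩
      push_cast
      refine hle _ _ fun h => h1 ?_
      exact ((chromaticIndex_le_iff (by lia)).1 h).succ_of_deleteEdges

/-- In a graph that becomes `n`-edge-colourable when the edge `vw` is deleted, but is not itself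
`n`-edge-colourable, `vw` can be given a colour that conflicts with exactly one edge, at `v`. -/
theorem exists_conflict_coloring {V : Type*} {G : SimpleGraph V} {n : ℕ} {v w : V}
    (hG : ¬ EdgeColorable G n) (hvw : G.Adj v w) (hdeg : (G.neighborSet w).encard ≤ n)
    (hdel : EdgeColorable (G.deleteEdges {s(v, w)}) n) :
    ∃ C : V → V → Fin n, (∀ u x, G.Adj u x → C u x = C x u) ∧
      (∀ u, u ≠ v → ∀ x y, G.Adj u x → G.Adj u y → C u x = C u y → x = y) ∧
      (∀ x y, G.Adj v x → G.Adj v y → x ≠ w → y ≠ w → C v x = C v y → x = y) ∧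
      ∃ x, x ≠ w ∧ G.Adj v x ∧ C v x = C v w := by
  classical
  obtain ⟨C, hs, hp⟩ := hdel
  simp only [SimpleGraph.deleteEdges_adj, Set.mem_singleton_iff] at hs hp
  have hne := hvw.ne
  -- Apart from `v`, the vertex `w` has at most `n - 1` neighbours, so some colour is missing there.
  obtain ⟨β, hβ⟩ : ∃ β : Fin n, ∀ x, G.Adj w x → x ≠ v → C w x ≠ β := by
    by_contra! h
    choose f hf1 hf2 hf3 using h
    have hinj : Function.Injective f := fun a b hab => by rw [← hf3 a, ← hf3 b, hab]
    have h1 : (Set.range f).encard = n := by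
      rw [← Set.image_univ, hinj.encard_image]; simp
    have h2 : insert v (Set.range f) ⊆ G.neighborSet w := by
      intro x hx
      rcases hx with rfl | ⟨a, rfl⟩
      · exact hvw.symm
      · exact hf1 a
    have h3 := (Set.encard_le_encard h2).trans hdeg
    rw [Set.encard_insert_of_notMem (by rintro ⟨a, ha⟩; exact hf2 a ha), h1] at h3
    exact absurd h3 (by exact_mod_cast (Nat.lt_succ_self n).not_ge)
  let C' : V → V → Fin n := fun u x => if s(u, x) = s(v, w) then β else C u x
  have hC' : ∀ u x, s(u, x) ≠ s(v, w) → C' u x = C u x := fun u x h => if_neg h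
  have hCβ : ∀ u x, s(u, x) = s(v, w) → C' u x = β := fun u x h => if_pos h
  have hsymm : ∀ u x, G.Adj u x → C' u x = C' x u := by
    intro u x hux
    by_cases h : s(u, x) = s(v, w)
    · rw [hCβ _ _ h, hCβ _ _ (Sym2.eq_swap.trans h)]
    · rw [hC' _ _ h, hC' _ _ (fun h' => h (Sym2.eq_swap.trans h')), hs _ _ ⟨hux, h⟩]
  have hother : ∀ u, u ≠ v → ∀ x y, G.Adj u x → G.Adj u y → C' u x = C' u y → x = y := by
    intro u huv x y hx hy hxy
    by_cases h : s(u, x) = s(v, w) <;> by_cases h' : s(u, y) = s(v, w)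
    · exact Sym2.congr_right.1 (h.trans h'.symm)
    · rw [hCβ _ _ h, hC' _ _ h'] at hxy
      simp only [Sym2.eq_iff, huv, false_and, false_or] at h
      obtain ⟨rfl, rfl⟩ := h
      refine absurd hxy.symm (hβ y hy ?_)
      rintro rfl
      exact h' Sym2.eq_swap
    · rw [hCβ _ _ h', hC' _ _ h] at hxy
      simp only [Sym2.eq_iff, huv, false_and, false_or] at h'
      obtain ⟨rfl, rfl⟩ := h'
      refine absurd hxy (hβ x hx ?_)
      rintro rfl
      exact h Sym2.eq_swap
    · rw [hC' _ _ h, hC' _ _ h'] at hxy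
      exact hp u x y ⟨hx, h⟩ ⟨hy, h'⟩ hxy
  have hv : ∀ x y, G.Adj v x → G.Adj v y → x ≠ w → y ≠ w → C' v x = C' v y → x = y := by
    intro x y hx hy hxw hyw hxy
    have h : s(v, x) ≠ s(v, w) := fun h => hxw (Sym2.congr_right.1 h)
    have h' : s(v, y) ≠ s(v, w) := fun h => hyw (Sym2.congr_right.1 h)
    rw [hC' _ _ h, hC' _ _ h'] at hxy
    exact hp v x y ⟨hx, h⟩ ⟨hy, h'⟩ hxy
  refine ⟨C', hsymm, hother, hv, ?_⟩
  -- Without a conflict at `v` the new colouring would be proper on all of `G`.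
  by_contra! h
  refine hG ⟨C', hsymm, fun u x y hx hy hxy => ?_⟩
  by_cases hu : u = v
  · subst hu
    by_cases h1 : x = w <;> by_cases h2 : y = w
    · rw [h1, h2]
    · subst h1; exact absurd hxy.symm (h y h2 hy)
    · subst h2; exact absurd hxy (h x h1 hx)
    · exact hv x y hx hy h1 h2 hxy
  · exact hother u hu x y hx hy hxy

/-! ### Colourings of a blob -/

/-- Every injective partial assignment of colours to slots extends to a bijection. -/
theorem exists_perm_extend {V : Type*} {n : ℕ} {N : Set V} {φ c : V → Fin n}
    (hφ : Set.InjOn φ N) (hc : Set.InjOn c N) :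
    ∃ σ : Equiv.Perm (Fin n), ∀ x ∈ N, σ (φ x) = c x := by
  classical
  by_cases hN : N.Nonempty
  swap
  · rw [Set.not_nonempty_iff_eq_empty] at hN
    exact ⟨1, by simp [hN]⟩
  have : Nonempty V := hN.to_type
  let f : Fin n → Fin n := c ∘ Function.invFunOn φ N
  have hf : ∀ x ∈ N, f (φ x) = c x := fun x hx => by
    simp only [f, Function.comp, hφ.leftInvOn_invFunOn hx]
  obtain ⟨g, hg⟩ := Finset.exists_equiv_extend_of_card_eq (α := Fin n) (t := Finset.univ)
    (by simp) (s := (φ '' N).toFinset) (f := f) (Finset.subset_univ _) (by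
      rintro a ha b hb hab
      simp only [Set.coe_toFinset] at ha hb
      obtain ⟨x, hx, rfl⟩ := ha
      obtain ⟨y, hy, rfl⟩ := hb
      rw [hf x hx, hf y hy] at hab
      rw [hc hx hy hab])
  refine ⟨g.trans (Equiv.subtypeUnivEquiv (by simp)), fun x hx => ?_⟩
  rw [← hf x hx, ← hg _ (by simpa using ⟨x, hx, rfl⟩)]
  rfl

/-- In a colouring of `K_{m+1,m}` with `m + 1` colours, the colours missing at the vertices of the
larger side are distinct. -/
theorem missing_colors_injective {m : ℕ} {D : Fin (m + 1) → Fin m → Fin (m + 1)}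
    (hcol : ∀ b a a', D a b = D a' b → a = a')
    (hrow : ∀ a b b', D a b = D a b' → b = b')
    {a a' : Fin (m + 1)} {β : Fin (m + 1)} (ha : ∀ b, D a b ≠ β) (ha' : ∀ b, D a' b ≠ β) :
    a = a' := by
  by_contra hne
  have hsurj : ∀ b, ∃ x, D x b = β := fun b =>
    Finite.surjective_of_injective (f := fun x => D x b) (fun x y h => hcol b x y h) β
  -- `f b` is the slot joined to `b` by colour `β`; these `m` distinct slots cannot all avoid both
  -- `a` and `a'`.
  choose f hf using hsurj
  have hinj : Function.Injective f := fun b b' h => hrow (f b) b b' (by rw [hf, h, hf])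
  have h1 : Finset.univ.image f ⊆ Finset.univ \ {a, a'} := by
    intro x hx
    simp only [Finset.mem_image, Finset.mem_univ, true_and] at hx
    obtain ⟨b, rfl⟩ := hx
    simp only [Finset.mem_sdiff, Finset.mem_univ, true_and, Finset.mem_insert,
      Finset.mem_singleton, not_or]
    exact ⟨fun h => ha b (h ▸ hf b), fun h => ha' b (h ▸ hf b)⟩
  have h2 := Finset.card_le_card h1
  rw [Finset.card_image_of_injective _ hinj, Finset.card_sdiff_of_subset (Finset.subset_univ _),
    Finset.card_pair hne] at h2
  simp only [Finset.card_univ, Fintype.card_fin] at h2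
  lia

/-- A cyclic Latin square of order `m + 1` with one column removed: the removed column becomes the
missing colours. -/
theorem exists_blob_coloring {m : ℕ} (σ : Equiv.Perm (Fin (m + 1))) :
    ∃ D : Fin (m + 1) → Fin m → Fin (m + 1),
      (∀ b a a', D a b = D a' b → a = a') ∧ (∀ a b b', D a b = D a b' → b = b') ∧
      ∀ a b, D a b ≠ σ a := by
  refine ⟨fun a b => σ (a + b.succ), fun b a a' h => ?_, fun a b b' h => ?_, fun a b h => ?_⟩
  · simpa using h
  · simpa using h
  · simp at h

/-- A colouring of `K_{m+1,m}` in which the colour `σ a` is missing at `a` and the edge `(a, j)` has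
the colour `σ a'`, where `a'` is the cyclic successor of `a` in the order given by `ρ`. -/
theorem exists_blob_coloring_of_label {m : ℕ} (σ ρ : Equiv.Perm (Fin (m + 1))) (j : Fin m) :
    ∃ D : Fin (m + 1) → Fin m → Fin (m + 1),
      (∀ b a a', D a b = D a' b → a = a') ∧ (∀ a b b', D a b = D a b' → b = b') ∧
      (∀ a b, D a b ≠ σ a) ∧ ∀ a a', ρ a' = ρ a + 1 → D a j = σ a' := by
  obtain ⟨n, rfl⟩ : ∃ n, m = n + 1 := ⟨m - 1, by have := j.2; lia⟩
  refine ⟨fun a b => σ (ρ.symm (ρ a + (Equiv.swap j 0 b).succ)), fun b a a' h => ?_,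
    fun a b b' h => ?_, fun a b h => ?_, fun a a' h => ?_⟩
  · simpa using h
  · simpa using h
  · simp [Equiv.symm_apply_eq] at h
  · simp [← h]

/-- If an edge `(i, j)` of `K_{m+1,m}` is deleted, the colour `σ f` outside the blob at `f` may be
replaced by `σ g`, provided that `i = f` or no colour is prescribed at `i`. -/
theorem exists_blob_coloring_delete {m : ℕ} (σ : Equiv.Perm (Fin (m + 1)))
    {i f g : Fin (m + 1)} (j : Fin m) (hig : i ≠ g) (hfg : f ≠ g) :
    ∃ D : Fin (m + 1) → Fin m → Fin (m + 1),
      (∀ b a a', ¬ (a = i ∧ b = j) → ¬ (a' = i ∧ b = j) → D a b = D a' b → a = a') ∧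
      (∀ a b b', ¬ (a = i ∧ b = j) → ¬ (a = i ∧ b' = j) → D a b = D a b' → b = b') ∧
      (∀ a b, a ≠ f → a ≠ i → D a b ≠ σ a) ∧
      ∀ b, ¬ (f = i ∧ b = j) → D f b ≠ σ g := by
  by_cases hif : i = f
  · subst hif
    obtain ⟨ρ, hρ⟩ := exists_perm_extend (V := Fin (m + 1)) (N := {i, g}) (φ := id)
      (c := fun a => if a = i then 0 else 1) (Function.injective_id.injOn) (by
        obtain ⟨n, rfl⟩ : ∃ n, m = n + 1 := ⟨m - 1, by have := j.2; lia⟩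
        intro a ha b hb
        simp only [Set.mem_insert_iff, Set.mem_singleton_iff] at ha hb
        rcases ha with rfl | rfl <;> rcases hb with rfl | rfl <;> simp [hig, hig.symm])
    obtain ⟨D, h1, h2, h3, h4⟩ := exists_blob_coloring_of_label σ ρ j
    have hi := hρ i (by simp)
    have hg := hρ g (by simp)
    simp only [id, if_true, hig.symm, if_false] at hi hg
    have hj := h4 i g (by rw [hi, hg, zero_add])
    refine ⟨D, fun b a a' _ _ => h1 b a a', fun a b b' _ _ => h2 a b b', fun a b _ _ => h3 a b,
      fun b hb h => hb ⟨rfl, h2 i b j (h.trans hj.symm)⟩⟩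
  · obtain ⟨n, rfl⟩ : ∃ n, m = n + 2 := by
      refine ⟨m - 2, ?_⟩
      have h1 := i.2
      have h2 := f.2
      have h3 := g.2
      simp only [ne_eq, Fin.ext_iff] at hig hfg hif
      lia
    have h12 : (1 : Fin (n + 3)) + 1 ≠ 1 := by simp
    have h02 : (1 : Fin (n + 3)) + 1 ≠ 0 := by
      simp [Fin.ext_iff, Fin.val_add, Nat.mod_eq_of_lt (show 2 < n + 3 by lia)]
    have hgf := hfg.symm
    have hgi := hig.symm
    have hfi : f ≠ i := fun h => hif h.symm
    -- In the cyclic order `i`, `f`, `g`, the edges `(i, j)` and `(f, j)` have colours `σ f` and `σ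
    -- g`. Deleting the first frees `σ f` at `j`; recolouring the second with `σ f` then frees `σ g`
    -- at `f`.
    obtain ⟨ρ, hρ⟩ := exists_perm_extend (V := Fin (n + 3)) (N := {i, f, g}) (φ := id)
      (c := fun a => if a = i then 0 else if a = f then 1 else 1 + 1)
      (Function.injective_id.injOn) (by
        intro a ha b hb
        simp only [Set.mem_insert_iff, Set.mem_singleton_iff] at ha hb
        rcases ha with rfl | rfl | rfl <;> rcases hb with rfl | rfl | rfl <;>
          simp [hig, hgi, hfg, hgf, hif, hfi, h12, h12.symm, h02, h02.symm, -Fin.reduceAdd])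
    obtain ⟨D, h1, h2, h3, h4⟩ := exists_blob_coloring_of_label σ ρ j
    have hi := hρ i (by simp)
    have hf := hρ f (by simp)
    have hg := hρ g (by simp)
    simp only [id, if_true, hgi, hgf, hfi, if_false] at hi hf hg
    have hij := h4 i f (by rw [hi, hf, zero_add])
    have hfj := h4 f g (by rw [hf, hg])
    let D' : Fin (n + 3) → Fin (n + 2) → Fin (n + 3) :=
      fun a b => if a = f ∧ b = j then σ f else D a b
    have hD : ∀ a b, ¬ (a = f ∧ b = j) → D' a b = D a b := fun a b h => if_neg h
    have hDf : D' f j = σ f := if_pos ⟨rfl, rfl⟩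
    refine ⟨D', ?_, ?_, ?_, ?_⟩
    · have aux : ∀ a, a ≠ i → a ≠ f → D' a j ≠ D' f j := by
        intro a hai haf h
        rw [hD _ _ (by tauto), hDf, ← hij] at h
        exact hai (h1 j a i h)
      intro b a a' ha ha' h
      by_cases hb : b = j
      · subst hb
        by_cases haf : a = f <;> by_cases haf' : a' = f
        · rw [haf, haf']
        · subst haf; exact absurd h.symm (aux a' (by tauto) haf')
        · subst haf'; exact absurd h (aux a (by tauto) haf)
        · rw [hD _ _ (by tauto), hD _ _ (by tauto)] at h
          exact h1 b a a' h
      · rw [hD _ _ (by tauto), hD _ _ (by tauto)] at h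
        exact h1 b a a' h
    · intro a b b' _ _ h
      by_cases haf : a = f
      · subst haf
        by_cases hb : b = j <;> by_cases hb' : b' = j
        · rw [hb, hb']
        · subst hb
          rw [hDf, hD _ _ (by tauto)] at h
          exact absurd h.symm (h3 _ _)
        · subst hb'
          rw [hDf, hD _ _ (by tauto)] at h
          exact absurd h (h3 _ _)
        · rw [hD _ _ (by tauto), hD _ _ (by tauto)] at h
          exact h2 a b b' h
      · rw [hD _ _ (by tauto), hD _ _ (by tauto)] at h
        exact h2 a b b' h
    · intro a b haf _
      rw [hD _ _ (by tauto)]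
      exact h3 a b
    · intro b _ h
      by_cases hb : b = j
      · subst hb
        rw [hDf] at h
        exact hfg (σ.injective h)
      · rw [hD _ _ (by tauto), ← hfj] at h
        exact hb (h2 f b j h)

/-! ### Blow-ups of matchings between slots -/

/-- The disjoint union of copies of `K_{m+1,m}` indexed by `V`, together with the edges of `X`
between the vertices of the larger sides (the slots). -/
def blowUp {V : Type*} {m : ℕ} (X : SimpleGraph (V × Fin (m + 1))) :
    SimpleGraph (V × (Fin (m + 1) ⊕ Fin m)) where
  Adj p q := match p, q with
    | (u, Sum.inl a), (v, Sum.inl b) => X.Adj (u, a) (v, b)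
    | (u, Sum.inl _), (v, Sum.inr _) => u = v
    | (u, Sum.inr _), (v, Sum.inl _) => u = v
    | (_, Sum.inr _), (_, Sum.inr _) => False
  symm := ⟨by
    rintro ⟨u, a | a⟩ ⟨v, b | b⟩ h
    · exact SimpleGraph.Adj.symm h
    · exact Eq.symm h
    · exact Eq.symm h
    · exact h⟩
  loopless := ⟨by
    rintro ⟨u, a | a⟩ h
    · exact X.loopless.irrefl _ h
    · exact h⟩

section BlowUp

variable {V : Type*} {m : ℕ} {X : SimpleGraph (V × Fin (m + 1))}

@[simp] theorem blowUp_adj_inl_inl {u v : V} {a b : Fin (m + 1)} :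
    (blowUp X).Adj (u, Sum.inl a) (v, Sum.inl b) ↔ X.Adj (u, a) (v, b) := Iff.rfl

@[simp] theorem blowUp_adj_inl_inr {u v : V} {a : Fin (m + 1)} {b : Fin m} :
    (blowUp X).Adj (u, Sum.inl a) (v, Sum.inr b) ↔ u = v := Iff.rfl

@[simp] theorem blowUp_adj_inr_inl {u v : V} {a : Fin (m + 1)} {b : Fin m} :
    (blowUp X).Adj (u, Sum.inr b) (v, Sum.inl a) ↔ u = v := Iff.rfl

@[simp] theorem blowUp_adj_inr_inr {u v : V} {a b : Fin m} :
    ¬ (blowUp X).Adj (u, Sum.inr a) (v, Sum.inr b) := fun h => h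

/-- Only slots meet both inner and outer edges, so `hext` is the only compatibility required between
the blob colourings and `c`. -/
theorem edgeColorable_of_blobs {H : SimpleGraph (V × (Fin (m + 1) ⊕ Fin m))}
    (hH : H ≤ blowUp X) (hX : ∀ p q r, X.Adj p q → X.Adj p r → q = r)
    (D : V → Fin (m + 1) → Fin m → Fin (m + 1)) (c : V → Fin (m + 1) → Fin (m + 1))
    (hc : ∀ u a v a', H.Adj (u, Sum.inl a) (v, Sum.inl a') → c u a = c v a')
    (hcol : ∀ u b a a', H.Adj (u, Sum.inl a) (u, Sum.inr b) →
      H.Adj (u, Sum.inl a') (u, Sum.inr b) → D u a b = D u a' b → a = a')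
    (hrow : ∀ u a b b', H.Adj (u, Sum.inl a) (u, Sum.inr b) →
      H.Adj (u, Sum.inl a) (u, Sum.inr b') → D u a b = D u a b' → b = b')
    (hext : ∀ u a b v a', H.Adj (u, Sum.inl a) (u, Sum.inr b) →
      H.Adj (u, Sum.inl a) (v, Sum.inl a') → D u a b ≠ c u a) :
    EdgeColorable H (m + 1) := by
  refine ⟨fun p q => match p, q with
    | (u, Sum.inl a), (_, Sum.inl _) => c u a
    | (u, Sum.inl a), (_, Sum.inr b) => D u a b
    | (_, Sum.inr b), (v, Sum.inl a) => D v a b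
    | (_, Sum.inr _), (_, Sum.inr _) => 0, ?_, ?_⟩
  · rintro ⟨u, a | a⟩ ⟨v, b | b⟩ h
    · exact hc _ _ _ _ h
    · rfl
    · rfl
    · rfl
  · rintro ⟨u, a | a⟩ ⟨v, b | b⟩ ⟨w, d | d⟩ h h' he
    · have := hX _ _ _ (hH h) (hH h')
      simp only [Prod.mk.injEq] at this ⊢
      exact ⟨this.1, congrArg _ this.2⟩
    · obtain rfl : u = w := hH h'
      exact absurd he.symm (hext _ _ _ _ _ h' h)
    · obtain rfl : u = v := hH h
      exact absurd he (hext _ _ _ _ _ h h')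
    · obtain rfl : u = v := hH h
      obtain rfl : u = w := hH h'
      rw [hrow _ _ _ _ h h' he]
    · obtain rfl : u = v := hH h
      obtain rfl : u = w := hH h'
      rw [hcol _ _ _ _ h.symm h'.symm he]
    · exact (hH h').elim
    · exact (hH h).elim
    · exact (hH h).elim

theorem edgeColorable_of_perm {H : SimpleGraph (V × (Fin (m + 1) ⊕ Fin m))}
    (hH : H ≤ blowUp X) (hX : ∀ p q r, X.Adj p q → X.Adj p r → q = r)
    (c : V → Fin (m + 1) → Fin (m + 1))
    (hc : ∀ u a v a', H.Adj (u, Sum.inl a) (v, Sum.inl a') → c u a = c v a')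
    (hσ : ∀ u, ∃ σ : Equiv.Perm (Fin (m + 1)), ∀ a v a',
      H.Adj (u, Sum.inl a) (v, Sum.inl a') → σ a = c u a) :
    EdgeColorable H (m + 1) := by
  choose σ hσ using hσ
  choose D h1 h2 h3 using fun u => exists_blob_coloring (σ u)
  refine edgeColorable_of_blobs hH hX D c hc (fun u b a a' _ _ => h1 u b a a')
    (fun u a b b' _ _ => h2 u a b b') fun u a b v a' _ h => ?_
  rw [← hσ u a v a' h]
  exact h3 u a b

/-- At the blob of `v` the outer colouring may repeat at `f` the colour assigned to `g`; the deleted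
inner edge absorbs this conflict. -/
theorem edgeColorable_deleteEdges_of_perm
    (hX : ∀ p q r, X.Adj p q → X.Adj p r → q = r) {v : V} {i f g : Fin (m + 1)} {j : Fin m}
    (c : V → Fin (m + 1) → Fin (m + 1))
    (hc : ∀ u a w a', X.Adj (u, a) (w, a') → c u a = c w a')
    (hσ : ∀ u, u ≠ v → ∃ σ : Equiv.Perm (Fin (m + 1)), ∀ a q, X.Adj (u, a) q → σ a = c u a)
    (hig : i ≠ g) (hfg : f ≠ g) (hi : i = f ∨ ∀ q, ¬ X.Adj (v, i) q)
    (hv : ∃ σ : Equiv.Perm (Fin (m + 1)), c v f = σ g ∧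
      ∀ a q, a ≠ f → X.Adj (v, a) q → σ a = c v a) :
    EdgeColorable ((blowUp X).deleteEdges {s((v, Sum.inl i), (v, Sum.inr j))}) (m + 1) := by
  classical
  have key : ∀ u, ∃ D : Fin (m + 1) → Fin m → Fin (m + 1),
      (∀ b a a', ¬ (u = v ∧ a = i ∧ b = j) → ¬ (u = v ∧ a' = i ∧ b = j) →
        D a b = D a' b → a = a') ∧
      (∀ a b b', ¬ (u = v ∧ a = i ∧ b = j) → ¬ (u = v ∧ a = i ∧ b' = j) →
        D a b = D a b' → b = b') ∧
      ∀ a b q, X.Adj (u, a) q → ¬ (u = v ∧ a = i ∧ b = j) → D a b ≠ c u a := by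
    intro u
    by_cases huv : u = v
    · subst huv
      obtain ⟨σ, hσf, hσ'⟩ := hv
      obtain ⟨D, h1, h2, h3, h4⟩ := exists_blob_coloring_delete σ j hig hfg
      refine ⟨D, by simpa using h1, by simpa using h2, fun a b q hq hab => ?_⟩
      by_cases haf : a = f
      · subst haf
        rw [hσf]
        exact h4 b (by tauto)
      · rw [← hσ' a q haf hq]
        refine h3 a b haf fun hai => ?_
        subst hai
        exact hi.elim haf fun h => h q hq
    · obtain ⟨σ, hσ'⟩ := hσ u huv
      obtain ⟨D, h1, h2, h3⟩ := exists_blob_coloring σ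
      refine ⟨D, fun b a a' _ _ => h1 b a a', fun a b b' _ _ => h2 a b b', fun a b q hq _ => ?_⟩
      rw [← hσ' a q hq]
      exact h3 a b
  choose D h1 h2 h3 using key
  have hdel : ∀ u a b, ((blowUp X).deleteEdges {s((v, Sum.inl i), (v, Sum.inr j))}).Adj
      (u, Sum.inl a) (u, Sum.inr b) → ¬ (u = v ∧ a = i ∧ b = j) := by
    rintro u a b h ⟨rfl, rfl, rfl⟩
    simp at h
  have hle := SimpleGraph.deleteEdges_le (G := blowUp X) {s((v, Sum.inl i), (v, Sum.inr j))}
  refine edgeColorable_of_blobs hle hX D c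
    (fun u a w a' h => hc u a w a' (hle h))
    (fun u b a a' h h' => h1 u b a a' (hdel _ _ _ h) (hdel _ _ _ h'))
    (fun u a b b' h h' => h2 u a b b' (hdel _ _ _ h) (hdel _ _ _ h'))
    (fun u a b w a' h h' => h3 u a b (w, a') (hle h') (hdel _ _ _ h))

open Classical in
theorem degree_eq_ncard {W : Type*} [Fintype W] (G : SimpleGraph W) (v : W) :
    G.degree v = (G.neighborSet v).ncard := by
  rw [Set.ncard_eq_toFinset_card']
  rfl

theorem ncard_neighborSet_inr (v : V) (b : Fin m) :
    ((blowUp X).neighborSet (v, Sum.inr b)).ncard = m + 1 := by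
  have : (blowUp X).neighborSet (v, Sum.inr b) = Set.range fun a : Fin (m + 1) => (v, Sum.inl a) := by
    ext ⟨w, a | a⟩ <;> simp [eq_comm]
  rw [this, ← Set.image_univ, Set.ncard_image_of_injective _ (fun a a' h => by simpa using h)]
  simp

theorem ncard_neighborSet_inl_of_forall_not_adj {v : V} {a : Fin (m + 1)}
    (h : ∀ q, ¬ X.Adj (v, a) q) : ((blowUp X).neighborSet (v, Sum.inl a)).ncard = m := by
  have : (blowUp X).neighborSet (v, Sum.inl a) = Set.range fun b : Fin m => (v, Sum.inr b) := by
    ext ⟨w, b | b⟩ <;> simp [eq_comm, h]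
  rw [this, ← Set.image_univ, Set.ncard_image_of_injective _ (fun a a' h => by simpa using h)]
  simp

theorem ncard_neighborSet_inl_of_adj (hX : ∀ p q r, X.Adj p q → X.Adj p r → q = r)
    {v w : V} {a a' : Fin (m + 1)} (h : X.Adj (v, a) (w, a')) :
    ((blowUp X).neighborSet (v, Sum.inl a)).ncard = m + 1 := by
  have : (blowUp X).neighborSet (v, Sum.inl a) =
      insert (w, Sum.inl a') (Set.range fun b : Fin m => (v, Sum.inr b)) := by
    ext ⟨u, b | b⟩
    · simp only [SimpleGraph.mem_neighborSet, blowUp_adj_inl_inl, Set.mem_insert_iff,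
        Prod.mk.injEq, Sum.inl.injEq, Set.mem_range, reduceCtorEq, and_false, exists_false, or_false]
      refine ⟨fun hu => by simpa using hX _ _ _ hu h, ?_⟩
      rintro ⟨rfl, rfl⟩
      exact h
    · simp [eq_comm]
  rw [this, Set.ncard_insert_of_notMem (by simp) (Set.finite_range _), ← Set.image_univ,
    Set.ncard_image_of_injective _ (fun a a' h => by simpa using h)]
  simp

open Classical in
theorem degree_blowUp [Fintype V] (hX : ∀ p q r, X.Adj p q → X.Adj p r → q = r)
    (x : V × (Fin (m + 1) ⊕ Fin m)) :
    (blowUp X).degree x = m + 1 ∨ (blowUp X).degree x = m := by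
  simp only [degree_eq_ncard]
  obtain ⟨v, a | b⟩ := x
  · by_cases h : ∃ q, X.Adj (v, a) q
    · obtain ⟨⟨w, a'⟩, h⟩ := h
      exact Or.inl (ncard_neighborSet_inl_of_adj hX h)
    · push Not at h
      exact Or.inr (ncard_neighborSet_inl_of_forall_not_adj h)
  · exact Or.inl (ncard_neighborSet_inr v b)

theorem mem_degreeSet_blowUp [Fintype V] (hX : ∀ p q r, X.Adj p q → X.Adj p r → q = r)
    {x : V × (Fin (m + 1) ⊕ Fin m)} :
    x ∈ degreeSet (blowUp X) m ↔ ∃ a, x.2 = Sum.inl a ∧ ∀ q, ¬ X.Adj (x.1, a) q := by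
  classical
  rw [degreeSet, Set.mem_ofPred_eq, degree_eq_ncard]
  obtain ⟨v, a | b⟩ := x
  · refine ⟨fun h => ⟨a, rfl, fun ⟨w, a'⟩ hq => ?_⟩, ?_⟩
    · rw [ncard_neighborSet_inl_of_adj hX hq] at h
      lia
    · rintro ⟨a', h, h'⟩
      obtain rfl : a = a' := by simpa using h
      exact ncard_neighborSet_inl_of_forall_not_adj h'
  · rw [ncard_neighborSet_inr]
    simp

open Classical in
theorem le_minDegree_blowUp [Fintype V] [Nonempty V]
    (hX : ∀ p q r, X.Adj p q → X.Adj p r → q = r) : m ≤ (blowUp X).minDegree :=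
  SimpleGraph.le_minDegree_of_forall_le_degree _ _ fun x => by
    rcases degree_blowUp hX x with h | h <;> lia

theorem isCritical_blowUp [Fintype V] [Nonempty V] (hm : 1 ≤ m)
    (hX : ∀ p q r, X.Adj p q → X.Adj p r → q = r)
    (hcol : ¬ EdgeColorable (blowUp X) (m + 1))
    (hin : ∀ v i j, EdgeColorable
      ((blowUp X).deleteEdges {s((v, Sum.inl i), (v, Sum.inr j))}) (m + 1))
    (hout : ∀ v a w a', X.Adj (v, a) (w, a') → EdgeColorable
      ((blowUp X).deleteEdges {s((v, Sum.inl a), (w, Sum.inl a'))}) (m + 1)) :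
    IsCritical (m + 1) (blowUp X) := by
  classical
  rw [isCritical_iff (by lia)]
  refine ⟨le_antisymm ?_ ?_, hcol, ?_⟩
  · refine SimpleGraph.maxDegree_le_of_forall_degree_le _ _ fun x => ?_
    rcases degree_blowUp hX x with h | h <;> lia
  · obtain ⟨v⟩ := ‹Nonempty V›
    have h := ncard_neighborSet_inr (X := X) v ⟨0, hm⟩
    rw [← degree_eq_ncard] at h
    exact h.ge.trans (SimpleGraph.degree_le_maxDegree _ _)
  · rintro ⟨v, a | a⟩ ⟨w, b | b⟩ h
    · exact hout v a w b h
    · obtain rfl : v = w := h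
      exact hin v a b
    · obtain rfl : v = w := h
      rw [Sym2.eq_swap]
      exact hin v b a
    · exact h.elim

/-- The colours that an edge-colouring of a blow-up gives to the edges of `X` at a blob are
distinct. -/
theorem slot_colors_injective {C : V × (Fin (m + 1) ⊕ Fin m) → V × (Fin (m + 1) ⊕ Fin m) →
      Fin (m + 1)} (hs : ∀ p q, (blowUp X).Adj p q → C p q = C q p)
    (hp : ∀ p q r, (blowUp X).Adj p q → (blowUp X).Adj p r → C p q = C p r → q = r)
    {v w w' : V} {a a' b b' : Fin (m + 1)} (h : X.Adj (v, a) (w, b)) (h' : X.Adj (v, a') (w', b'))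
    (he : C (v, Sum.inl a) (w, Sum.inl b) = C (v, Sum.inl a') (w', Sum.inl b')) : a = a' := by
  refine missing_colors_injective (D := fun a b => C (v, Sum.inl a) (v, Sum.inr b))
    (β := C (v, Sum.inl a) (w, Sum.inl b)) ?_ ?_ ?_ ?_
  · intro b a a' he
    rw [hs _ (v, Sum.inr b) (by simp), hs _ (v, Sum.inr b) (by simp)] at he
    simpa using hp _ _ _ (by simp) (by simp) he
  · intro a b b' he
    simpa using hp _ _ _ (by simp) (by simp) he
  · intro b he
    simpa using hp _ _ _ (by simp) (by simpa using h) he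
  · intro b hb
    simpa using hp _ _ _ (by simp) (by simpa using h') (hb.trans he)

end BlowUp

/-! ### The initial critical graph -/

/-- The graph consisting of one edge between the slots `0` and `1` of a single blob. -/
def slotEdge (m : ℕ) : SimpleGraph (Unit × Fin (m + 1)) where
  Adj p q := p.2 ≠ q.2 ∧ (p.2 = 0 ∨ p.2 = 1) ∧ (q.2 = 0 ∨ q.2 = 1)
  symm := ⟨fun _ _ h => ⟨h.1.symm, h.2.2, h.2.1⟩⟩
  loopless := ⟨fun _ h => h.1 rfl⟩

theorem slotEdge_matching {m : ℕ} (p q r : Unit × Fin (m + 1)) (hq : (slotEdge m).Adj p q)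
    (hr : (slotEdge m).Adj p r) : q = r := by
  obtain ⟨h1, h2, h3⟩ := hq
  obtain ⟨h4, -, h5⟩ := hr
  refine Prod.ext rfl ?_
  rcases h2 with h2 | h2 <;> rcases h3 with h3 | h3 <;> rcases h5 with h5 | h5 <;> simp_all

theorem isCritical_blowUp_slotEdge {m : ℕ} (hm : 1 ≤ m) :
    IsCritical (m + 1) (blowUp (slotEdge m)) := by
  have h01 : (0 : Fin (m + 1)) ≠ 1 := by
    obtain ⟨n, rfl⟩ : ∃ n, m = n + 1 := ⟨m - 1, by lia⟩
    simp
  refine isCritical_blowUp hm slotEdge_matching ?_ ?_ ?_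
  · rintro ⟨C, hs, hp⟩
    have h : (slotEdge m).Adj ((), 0) ((), 1) := ⟨h01, Or.inl rfl, Or.inr rfl⟩
    exact h01 (slot_colors_injective hs hp h h.symm (hs _ _ h))
  · rintro ⟨⟩ i j
    -- `f` and `g` are the two ends `0` and `1`, ordered so that `i ≠ g`.
    obtain ⟨f, g, hfg, hf, hig, hi⟩ : ∃ f g : Fin (m + 1), f ≠ g ∧
        (∀ a, a = 0 ∨ a = 1 → a = f ∨ a = g) ∧ i ≠ g ∧ (i = f ∨ (i ≠ 0 ∧ i ≠ 1)) := by
      by_cases h1 : i = 1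
      · exact ⟨1, 0, h01.symm, fun a ha => ha.symm, by rw [h1]; exact h01.symm, Or.inl h1⟩
      · by_cases h0 : i = 0
        · exact ⟨0, 1, h01, fun a ha => ha, h1, Or.inl h0⟩
        · exact ⟨0, 1, h01, fun a ha => ha, h1, Or.inr ⟨h0, h1⟩⟩
    refine edgeColorable_deleteEdges_of_perm slotEdge_matching (f := f) (g := g)
      (fun _ _ => 0) (fun _ _ _ _ _ => rfl) (fun u hu => absurd rfl hu) hig hfg ?_ ?_
    · refine hi.imp id fun h q hq => ?_
      exact hq.2.1.elim h.1 h.2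
    · refine ⟨Equiv.swap 0 g, by simp, fun a q haf hq => ?_⟩
      obtain rfl := (hf a hq.2.1).resolve_left haf
      simp
  · rintro ⟨⟩ a ⟨⟩ a' h
    refine edgeColorable_of_perm (SimpleGraph.deleteEdges_le _) slotEdge_matching
      (fun _ _ => 0) (fun _ _ _ _ _ => rfl) fun _ => ⟨1, ?_⟩
    rintro b ⟨⟩ b' hb
    rw [SimpleGraph.deleteEdges_adj] at hb
    refine absurd ?_ hb.2
    obtain ⟨h1, h2, h3⟩ := h
    obtain ⟨h4, h5, h6⟩ := hb.1
    simp only at h1 h2 h3 h4 h5 h6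
    simp only [Set.mem_singleton_iff, Sym2.eq_iff, Prod.mk.injEq, Sum.inl.injEq, true_and]
    rcases h2 with rfl | rfl <;> rcases h3 with rfl | rfl <;> rcases h5 with rfl | rfl <;>
      rcases h6 with rfl | rfl <;> simp_all

/-! ### The Meredith extension is critical -/

/-- The matching of slots that represents the edges of `G`: the end `v` of the edge `vw` occupies
the slot `φ v w` of the blob of `v`. -/
def slotGraph {V : Type*} {n : ℕ} (G : SimpleGraph V) (φ : V → V → Fin n) :
    SimpleGraph (V × Fin n) where
  Adj p q := G.Adj p.1 q.1 ∧ φ p.1 q.1 = p.2 ∧ φ q.1 p.1 = q.2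
  symm := ⟨fun _ _ h => ⟨h.1.symm, h.2.2, h.2.1⟩⟩
  loopless := ⟨fun _ h => h.1.ne rfl⟩

section Meredith

variable {V : Type*} {m : ℕ} {G : SimpleGraph V} {φ : V → V → Fin (m + 1)}

theorem slotGraph_adj {v w : V} {a b : Fin (m + 1)} :
    (slotGraph G φ).Adj (v, a) (w, b) ↔ G.Adj v w ∧ φ v w = a ∧ φ w v = b := Iff.rfl

theorem slotGraph_adj_of_adj {v w : V} (h : G.Adj v w) :
    (slotGraph G φ).Adj (v, φ v w) (w, φ w v) := ⟨h, rfl, rfl⟩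

theorem slotGraph_matching (hφ : ∀ v, Set.InjOn (φ v) (G.neighborSet v)) (p q r : V × Fin (m + 1))
    (hq : (slotGraph G φ).Adj p q) (hr : (slotGraph G φ).Adj p r) : q = r := by
  obtain ⟨v, a⟩ := p
  obtain ⟨w, b⟩ := q
  obtain ⟨u, d⟩ := r
  obtain ⟨h1, h2, h3⟩ := hq
  obtain ⟨h4, h5, h6⟩ := hr
  simp only at h1 h2 h3 h4 h5 h6
  obtain rfl := hφ v h1 h4 (h2.trans h5.symm)
  rw [← h3, ← h6]

theorem exists_slot_color (hφ : ∀ v, Set.InjOn (φ v) (G.neighborSet v))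
    (C : V → V → Fin (m + 1)) :
    ∃ c : V → Fin (m + 1) → Fin (m + 1), ∀ v w, G.Adj v w → c v (φ v w) = C v w := by
  classical
  refine ⟨fun v a => if h : ∃ w, G.Adj v w ∧ φ v w = a then C v h.choose else 0, fun v w h => ?_⟩
  have h' : ∃ w', G.Adj v w' ∧ φ v w' = φ v w := ⟨w, h, rfl⟩
  simp only
  rw [dif_pos h', hφ v h'.choose_spec.1 h h'.choose_spec.2]

/-- A colouring of the extension restricts to one of `G`, since outer edges at a blob get distinct
colours. Deleting an outer edge corresponds to deleting an edge of `G`. For an inner edge at the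
blob of `v`, a colouring of `G` with a single conflict at `v` is lifted. -/
theorem isCritical_meredith [Fintype V] [Nonempty V] (hm : 1 ≤ m)
    (hφ : ∀ v, Set.InjOn (φ v) (G.neighborSet v)) (hcrit : IsCritical (m + 1) G)
    (hdeg : ∀ v, ∃ w, G.Adj v w) : IsCritical (m + 1) (blowUp (slotGraph G φ)) := by
  classical
  obtain ⟨hmax, hcol, hdel⟩ := (isCritical_iff (by lia)).1 hcrit
  have hle : ∀ v, (G.neighborSet v).encard ≤ ((m + 1 : ℕ) : ℕ∞) := fun v => by
    rw [← (Set.toFinite _).cast_ncard_eq, ← degree_eq_ncard, Nat.cast_le]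
    exact hmax ▸ G.degree_le_maxDegree v
  refine isCritical_blowUp hm (slotGraph_matching hφ) ?_ ?_ ?_
  · rintro ⟨C, hs, hp⟩
    refine hcol ⟨fun v w => C (v, Sum.inl (φ v w)) (w, Sum.inl (φ w v)), fun v w h => ?_,
      fun v w w' h h' he => ?_⟩
    · exact hs _ _ (slotGraph_adj_of_adj h)
    · exact hφ v h h'
        (slot_colors_injective hs hp (slotGraph_adj_of_adj h) (slotGraph_adj_of_adj h') he)
  · intro v i j
    -- If slot `i` is occupied, `w` is the neighbour it serves; if it is free, any neighbour will
    -- do.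
    obtain ⟨w, hvw, hw⟩ : ∃ w, G.Adj v w ∧ ∀ x, G.Adj v x → φ v x = i → x = w := by
      by_cases h : ∃ x, G.Adj v x ∧ φ v x = i
      · obtain ⟨x, hx, hxi⟩ := h
        exact ⟨x, hx, fun y hy hyi => hφ v hy hx (hyi.trans hxi.symm)⟩
      · push Not at h
        obtain ⟨w, hw⟩ := hdeg v
        exact ⟨w, hw, fun x hx hxi => absurd hxi (h x hx)⟩
    obtain ⟨C, hs, hp, hpv, x, hxw, hx, hxC⟩ :=
      exists_conflict_coloring hcol hvw (hle w) (hdel v w hvw)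
    obtain ⟨c, hc⟩ := exists_slot_color hφ C
    refine edgeColorable_deleteEdges_of_perm (slotGraph_matching hφ) (f := φ v w) (g := φ v x) c
      ?_ ?_ ?_ ?_ ?_ ?_
    · intro u a y a' huy
      obtain ⟨h, rfl, rfl⟩ := slotGraph_adj.1 huy
      rw [hc _ _ h, hc _ _ h.symm, hs _ _ h]
    · intro u hu
      obtain ⟨σ, hσ⟩ := exists_perm_extend (hφ u) (c := C u) (fun y hy z hz => hp u hu y z hy hz)
      refine ⟨σ, ?_⟩
      rintro a ⟨y, a'⟩ huy
      obtain ⟨h, rfl, rfl⟩ := slotGraph_adj.1 huy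
      rw [hσ y h, hc _ _ h]
    · rintro rfl
      exact hxw (hw x hx rfl)
    · exact fun h => hxw (hφ v hx hvw h.symm)
    · by_contra! h
      obtain ⟨hi, ⟨y, a'⟩, hvy⟩ := h
      obtain ⟨hy, rfl, rfl⟩ := slotGraph_adj.1 hvy
      obtain rfl := hw y hy rfl
      exact hi rfl
    -- Leaving out `w` makes the colours at `v` injective; the colour of `vw` is the one assigned to
    -- the slot of `x`.
    · obtain ⟨σ, hσ⟩ := exists_perm_extend (N := {y | G.Adj v y ∧ y ≠ w}) (φ := φ v) (c := C v)
        (fun y hy z hz h => hφ v hy.1 hz.1 h) (fun y hy z hz => hpv y z hy.1 hz.1 hy.2 hz.2)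
      refine ⟨σ, ?_, ?_⟩
      · rw [hc _ _ hvw, hσ x ⟨hx, hxw⟩, hxC]
      · rintro a ⟨y, a'⟩ ha hvy
        obtain ⟨h, rfl, rfl⟩ := slotGraph_adj.1 hvy
        rw [hσ y ⟨h, fun hyw => ha (by rw [hyw])⟩, hc _ _ h]
  · intro v a w a' hX
    obtain ⟨hvw, rfl, rfl⟩ := slotGraph_adj.1 hX
    obtain ⟨C, hs, hp⟩ := hdel v w hvw
    obtain ⟨c, hc⟩ := exists_slot_color hφ C
    have key : ∀ u a y a', ((blowUp (slotGraph G φ)).deleteEdges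
        {s((v, Sum.inl (φ v w)), (w, Sum.inl (φ w v)))}).Adj (u, Sum.inl a) (y, Sum.inl a') →
        (G.deleteEdges {s(v, w)}).Adj u y ∧ φ u y = a ∧ φ y u = a' := by
      rintro u a y a' h
      rw [SimpleGraph.deleteEdges_adj] at h ⊢
      obtain ⟨⟨h1, h2, h3⟩, h4⟩ := h
      simp only at h1 h2 h3
      refine ⟨⟨h1, fun h => h4 ?_⟩, h2, h3⟩
      subst h2 h3
      rw [Set.mem_singleton_iff, Sym2.eq_iff] at h
      rcases h with ⟨rfl, rfl⟩ | ⟨rfl, rfl⟩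
      · rfl
      · exact Sym2.eq_swap
    have hle := SimpleGraph.deleteEdges_le (G := G) {s(v, w)}
    refine edgeColorable_of_perm (SimpleGraph.deleteEdges_le _) (slotGraph_matching hφ) c ?_ ?_
    · intro u a y a' huy
      obtain ⟨h, rfl, rfl⟩ := key _ _ _ _ huy
      rw [hc _ _ (hle h), hc _ _ (hle h.symm), hs _ _ h]
    · intro u
      obtain ⟨σ, hσ⟩ := exists_perm_extend (N := (G.deleteEdges {s(v, w)}).neighborSet u)
        (φ := φ u) (c := C u) (fun y hy z hz h => hφ u (hle hy) (hle hz) h)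
        (fun y hy z hz h => hp u y z hy hz h)
      refine ⟨σ, fun a y a' huy => ?_⟩
      obtain ⟨h, rfl, rfl⟩ := key _ _ _ _ huy
      rw [hσ y h, hc _ _ (hle h)]

/-! ### Slots and independent sets -/

open Classical in
theorem exists_slots [Fintype V] (h : ∀ v, G.degree v ≤ m + 1) :
    ∃ φ : V → V → Fin (m + 1), ∀ v, Set.InjOn (φ v) (G.neighborSet v) := by
  have : ∀ v, ∃ f : V → Fin (m + 1), Set.InjOn f (G.neighborSet v) := by
    intro v
    obtain ⟨g⟩ : Nonempty (G.neighborSet v ↪ Fin (m + 1)) :=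
      Function.Embedding.nonempty_of_card_le (by
        rw [SimpleGraph.card_neighborSet_eq_degree, Fintype.card_fin]; exact h v)
    refine ⟨fun w => if hw : w ∈ G.neighborSet v then g ⟨w, hw⟩ else 0, fun x hx y hy hxy => ?_⟩
    simp only [hx, hy, dif_pos] at hxy
    simpa using hxy
  choose φ hφ using this
  exact ⟨φ, hφ⟩

open Classical in
-- Taking larger sides over an independent set `I` and smaller sides elsewhere gives `|V| * m + |I|`
-- independent vertices out of `|V| * (2 * m + 1)`, so the defect `|V| - 2 * |I|` is unchanged.
theorem card_le_indepNum_blowUp [Fintype V] {n : ℕ} (h : Fintype.card V ≤ 2 * G.indepNum + n) :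
    Fintype.card (V × (Fin (m + 1) ⊕ Fin m)) ≤ 2 * (blowUp (slotGraph G φ)).indepNum + n := by
  obtain ⟨I, hI⟩ := G.exists_isNIndepSet_indepNum
  let J : Finset (V × (Fin (m + 1) ⊕ Fin m)) :=
    (I ×ˢ Finset.univ.image Sum.inl) ∪ (Iᶜ ×ˢ Finset.univ.image Sum.inr)
  have hJ : (blowUp (slotGraph G φ)).IsIndepSet J := by
    rintro ⟨v, a | a⟩ hv ⟨w, b | b⟩ hw - hadj <;> simp [J] at hv hw
    · exact hI.isIndepSet hv hw hadj.1.ne hadj.1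
    · obtain rfl : v = w := hadj
      exact hw hv
    · obtain rfl : v = w := hadj
      exact hv hw
    · exact hadj
  have hcard : J.card = G.indepNum * (m + 1) + (Fintype.card V - G.indepNum) * m := by
    rw [Finset.card_union_of_disjoint]
    · simp [Finset.card_image_of_injective _ Sum.inl_injective,
        Finset.card_image_of_injective _ Sum.inr_injective, Finset.card_compl, hI.card_eq]
    · rw [Finset.disjoint_left]
      rintro ⟨v, a⟩ h1 h2
      simp only [Finset.mem_product, Finset.mem_compl] at h1 h2
      exact h2.1 h1.1
  have h1 := hJ.card_le_indepNum
  have h2 : G.indepNum ≤ Fintype.card V := hI.card_eq ▸ Finset.card_le_univ I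
  obtain ⟨d, hd⟩ := Nat.exists_eq_add_of_le h2
  rw [hcard, hd, Nat.add_sub_cancel_left] at h1
  rw [hd] at h
  simp only [Fintype.card_prod, Fintype.card_sum, Fintype.card_fin, hd]
  nlinarith

end Meredith

theorem card_le_indepNum_blowUp_slotEdge (m : ℕ) :
    Fintype.card (Unit × (Fin (m + 1) ⊕ Fin m)) ≤ 2 * (blowUp (slotEdge m)).indepNum + 1 := by
  classical
  let J : Finset (Unit × (Fin (m + 1) ⊕ Fin m)) := Finset.univ.image fun b => ((), Sum.inr b)
  have hJ : (blowUp (slotEdge m)).IsIndepSet J := by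
    rintro ⟨v, a | a⟩ hv ⟨w, b | b⟩ hw - hadj <;> simp [J] at hv hw
    exact hadj
  have h := hJ.card_le_indepNum
  rw [Finset.card_image_of_injective _ (fun a b h => by simpa using h), Finset.card_univ,
    Fintype.card_fin] at h
  simp
  lia

/-! ### Distinguished paths in the extension -/

/-- Every vertex of degree `n` is the initial vertex of `n` paths of length at least `L` that avoid
the other vertices of degree `n` and are disjoint apart from common initial vertices. -/
def HasLongPaths {V : Type*} [Fintype V] (n L : ℕ) (G : SimpleGraph V) : Prop :=
  ∃ (z : V → Fin n → V) (p : ∀ (v : V) (i : Fin n), G.Walk v (z v i)),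
    ∀ v ∈ degreeSet G n,
      (∀ i, (p v i).IsPath) ∧
      (∀ i, L ≤ (p v i).length) ∧
      (∀ i, ∀ x ∈ (p v i).support, x ∈ degreeSet G n → x = v) ∧
      (∀ i j, i ≠ j → ∀ x ∈ (p v i).support, x ∈ (p v j).support → x = v) ∧
      (∀ w ∈ degreeSet G n, w ≠ v → ∀ i j, ∀ x ∈ (p v i).support, x ∉ (p w j).support)

theorem HasLongPaths.hasDistinguishedPaths {V : Type*} [Fintype V] {m L t : ℕ}
    {G : SimpleGraph V} (h : HasLongPaths m L G) (hL : 2 * t * m + 1 ≤ L) :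
    HasDistinguishedPaths (m + 1) t G := by
  classical
  obtain ⟨z, p, hp⟩ := h
  refine ⟨z, p, fun v hv => ?_⟩
  obtain ⟨h1, h2, h3, h4, h5⟩ := hp v hv
  refine ⟨h1, fun i => ?_, fun i => ?_, fun i j hij => ?_, fun w hw hwv i j => ?_⟩
  · ext x
    refine ⟨fun hx => h3 i x hx.1 hx.2, ?_⟩
    rintro rfl
    exact ⟨(p x i).start_mem_support, hv⟩
  · have h6 : walkVerts (p v i) = ((p v i).support.toFinset : Set V) := by ext x; simp [walkVerts]
    rw [h6, Set.ncard_coe_finset, List.toFinset_card_of_nodup (h1 i).support_nodup,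
      SimpleGraph.Walk.length_support]
    have := h2 i
    simp only [Nat.add_sub_cancel]
    lia
  · ext x
    refine ⟨fun hx => h4 i j hij x hx.1 hx.2, ?_⟩
    rintro rfl
    exact ⟨(p x i).start_mem_support, (p x j).start_mem_support⟩
  · rw [Set.eq_empty_iff_forall_notMem]
    exact fun x hx => h5 w hw hwv i j x hx.1 hx.2

section Meredith

variable {V : Type*} {m : ℕ} {G : SimpleGraph V} {φ : V → V → Fin (m + 1)}

/-- A path of `G` starting at `u` lifts to a path of three times its length, starting at a slot of
the blob of `u` that is not used by an edge to the path. -/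
theorem exists_lift_path (hφ : ∀ v, Set.InjOn (φ v) (G.neighborSet v)) (b : Fin m) {u z : V}
    (p : G.Walk u z) (hp : p.IsPath) (a : Fin (m + 1))
    (ha : ∀ w ∈ p.support, G.Adj u w → φ u w ≠ a) :
    ∃ (z' : _) (q : (blowUp (slotGraph G φ)).Walk (u, Sum.inl a) z'), q.IsPath ∧
      q.length = 3 * p.length ∧ ∀ y ∈ q.support, y.1 ∈ p.support ∧
        (y.1 = u → y.2 = Sum.inl a ∨ y.2 = Sum.inr b ∨
          ∃ w ∈ p.support, G.Adj u w ∧ y.2 = Sum.inl (φ u w)) := by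
  induction p generalizing a with
  | nil => exact ⟨_, .nil, by simp, by simp, by simp⟩
  | @cons u v w h p ih =>
    -- Each edge `uv` becomes three: from slot `a` to `b`, to the slot of `uv` at `u`, and across to
    -- the slot of `uv` at `v`. The last slot can start the remaining lift because `u` is not on the
    -- rest of the path.
    rw [SimpleGraph.Walk.cons_isPath_iff] at hp
    obtain ⟨z', q, hq, hlen, hsupp⟩ := ih hp.1 (φ v u) (fun x hx hvx he =>
      hp.2 (hφ v hvx h.symm he ▸ hx))
    have hv : v ∈ (SimpleGraph.Walk.cons h p).support := by simp
    have h1 : (blowUp (slotGraph G φ)).Adj (u, Sum.inl a) (u, Sum.inr b) := by simp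
    have h2 : (blowUp (slotGraph G φ)).Adj (u, Sum.inr b) (u, Sum.inl (φ u v)) := by simp
    have h3 : (blowUp (slotGraph G φ)).Adj (u, Sum.inl (φ u v)) (v, Sum.inl (φ v u)) :=
      slotGraph_adj_of_adj h
    have hu : ∀ s, (u, s) ∉ q.support := fun s hs => hp.2 (hsupp _ hs).1
    refine ⟨z', .cons h1 (.cons h2 (.cons h3 q)), ?_, ?_, ?_⟩
    · simp only [SimpleGraph.Walk.cons_isPath_iff, SimpleGraph.Walk.support_cons, List.mem_cons,
        not_or]
      refine ⟨⟨⟨hq, hu _⟩, by simp, hu _⟩, by simp, ?_, hu _⟩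
      simpa using (ha v hv h).symm
    · simp only [SimpleGraph.Walk.length_cons, hlen]
      ring
    · intro y hy
      simp only [SimpleGraph.Walk.support_cons, List.mem_cons] at hy ⊢
      rcases hy with rfl | rfl | rfl | hy
      · simp
      · simp
      · exact ⟨Or.inl rfl, fun _ => Or.inr (Or.inr ⟨v, by simp, h, rfl⟩)⟩
      · refine ⟨Or.inr (hsupp y hy).1, fun hyu => ?_⟩
        subst hyu
        exact absurd hy (hu _)

theorem forall_slotGraph_not_adj {v : V} {a : Fin (m + 1)} :
    (∀ q, ¬ (slotGraph G φ).Adj (v, a) q) ↔ ∀ w, G.Adj v w → φ v w ≠ a :=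
  ⟨fun h w hw he => h (w, φ w v) ⟨hw, he, rfl⟩, fun h q hq => h q.1 hq.1 hq.2.1⟩

open Classical in
-- At least `m` of the `m + 1` slots are occupied, so at most one is free.
theorem mem_degreeSet_of_forall_ne [Fintype V]
    (hφ : ∀ v, Set.InjOn (φ v) (G.neighborSet v)) (hmin : m ≤ G.minDegree) {v : V}
    {a : Fin (m + 1)} (ha : ∀ w, G.Adj v w → φ v w ≠ a) :
    v ∈ degreeSet G m ∧ ∀ a', (∀ w, G.Adj v w → φ v w ≠ a') → a' = a := by
  have hcard : ((G.neighborFinset v).image (φ v)).card = G.degree v := by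
    rw [Finset.card_image_of_injOn (by simpa using hφ v), SimpleGraph.card_neighborFinset_eq_degree]
  have hge := hmin.trans (G.minDegree_le_degree v)
  have key : ∀ s : Finset (Fin (m + 1)), (∀ x ∈ s, ∀ w, G.Adj v w → φ v w ≠ x) →
      G.degree v ≤ m + 1 - s.card := by
    intro s hs
    have : (G.neighborFinset v).image (φ v) ⊆ sᶜ := by
      intro x hx
      simp only [Finset.mem_image, SimpleGraph.mem_neighborFinset] at hx
      obtain ⟨w, hw, rfl⟩ := hx
      rw [Finset.mem_compl]
      exact fun h => hs _ h w hw rfl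
    have := Finset.card_le_card this
    rwa [hcard, Finset.card_compl, Fintype.card_fin] at this
  refine ⟨?_, fun a' ha' => ?_⟩
  · have := key {a} (by simpa using ha)
    simp only [Finset.card_singleton] at this
    exact le_antisymm this hge
  · by_contra hne
    have := key {a', a} (by
      intro x hx
      simp only [Finset.mem_insert, Finset.mem_singleton] at hx
      rcases hx with rfl | rfl
      · exact ha'
      · exact ha)
    rw [Finset.card_pair hne] at this
    have h1 := a.2
    have h2 := a'.2
    rw [← ne_eq, ne_eq, Fin.ext_iff] at hne
    lia

open Classical in
/-- The vertices of degree `m` of the Meredith extension are the free slots, at most one in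
each blob. -/
theorem mem_degreeSet_meredith [Fintype V] (hφ : ∀ v, Set.InjOn (φ v) (G.neighborSet v))
    (hmin : m ≤ G.minDegree) {x : V × (Fin (m + 1) ⊕ Fin m)}
    (hx : x ∈ degreeSet (blowUp (slotGraph G φ)) m) :
    ∃ v a, x = (v, Sum.inl a) ∧ v ∈ degreeSet G m ∧ (∀ w, G.Adj v w → φ v w ≠ a) ∧
      ∀ y ∈ degreeSet (blowUp (slotGraph G φ)) m, y.1 = v → y = x := by
  obtain ⟨v, s⟩ := x
  rw [mem_degreeSet_blowUp (slotGraph_matching hφ)] at hx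
  obtain ⟨a, ha, h⟩ := hx
  obtain rfl : s = _ := ha
  rw [forall_slotGraph_not_adj] at h
  obtain ⟨hv, huniq⟩ := mem_degreeSet_of_forall_ne hφ hmin h
  refine ⟨v, a, rfl, hv, h, ?_⟩
  rintro ⟨w, s⟩ hy hw
  obtain rfl : w = _ := hw
  rw [mem_degreeSet_blowUp (slotGraph_matching hφ)] at hy
  obtain ⟨a', ha', h'⟩ := hy
  obtain rfl : s = _ := ha'
  rw [forall_slotGraph_not_adj] at h'
  rw [huniq a' h']

open Classical in
-- A free slot is joined to the `m` smaller-side vertices of its blob; different free slots lie in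
-- different blobs, so these edges cause no collisions.
theorem hasLongPaths_one_meredith [Fintype V] (hφ : ∀ v, Set.InjOn (φ v) (G.neighborSet v))
    (hmin : m ≤ G.minDegree) : HasLongPaths m 1 (blowUp (slotGraph G φ)) := by
  have : ∀ (x : V × (Fin (m + 1) ⊕ Fin m)) (i : Fin m),
      ∃ (z : _) (q : (blowUp (slotGraph G φ)).Walk x z),
        x ∈ degreeSet (blowUp (slotGraph G φ)) m →
          q.IsPath ∧ q.length = 1 ∧ ∀ y ∈ q.support, y = x ∨ y = (x.1, Sum.inr i) := by
    intro x i
    by_cases hx : x ∈ degreeSet (blowUp (slotGraph G φ)) m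
    · obtain ⟨v, a, rfl, -⟩ := mem_degreeSet_meredith hφ hmin hx
      have h : (blowUp (slotGraph G φ)).Adj (v, Sum.inl a) (v, Sum.inr i) := by simp
      exact ⟨_, .cons h .nil, fun _ => ⟨by simp, by simp, by simp⟩⟩
    · exact ⟨x, .nil, fun h => absurd h hx⟩
  choose z q hq using this
  refine ⟨z, q, fun x hx => ⟨fun i => (hq x i hx).1, fun i => (hq x i hx).2.1.ge, ?_, ?_, ?_⟩⟩
  · intro i y hy hyd
    refine ((hq x i hx).2.2 y hy).resolve_right fun h => ?_
    obtain ⟨w, a, h', -⟩ := mem_degreeSet_meredith hφ hmin hyd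
    simp [h] at h'
  · intro i j hij y hy hy'
    rcases (hq x i hx).2.2 y hy with h | h
    · exact h
    rcases (hq x j hx).2.2 y hy' with h' | h'
    · exact h'
    · rw [h] at h'
      simp [hij] at h'
  · intro w hw hwx i j y hy hy'
    obtain ⟨v, a, rfl, -, -, huniq⟩ := mem_degreeSet_meredith hφ hmin hx
    refine hwx (huniq w hw ?_)
    have h1 : y.1 = v := by
      rcases (hq _ i hx).2.2 y hy with h | h <;> rw [h]
    have h2 : y.1 = w.1 := by
      rcases (hq _ j hw).2.2 y hy' with h | h <;> rw [h]
    rw [← h2, h1]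

open Classical in
-- The `i`-th path is lifted through the smaller-side vertex `i` of each blob. Lifts can only share
-- a blob if the original paths share its vertex, hence only the initial blob, where distinct `i`
-- and distinct exit slots separate them.
theorem HasLongPaths.meredith [Fintype V] (hφ : ∀ v, Set.InjOn (φ v) (G.neighborSet v))
    (hmin : m ≤ G.minDegree) {L : ℕ} (hL : HasLongPaths m L G) :
    HasLongPaths m (3 * L) (blowUp (slotGraph G φ)) := by
  obtain ⟨z, p, hp⟩ := hL
  have : ∀ (x : V × (Fin (m + 1) ⊕ Fin m)) (i : Fin m),
      ∃ (z' : _) (q : (blowUp (slotGraph G φ)).Walk x z'),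
        x ∈ degreeSet (blowUp (slotGraph G φ)) m →
          q.IsPath ∧ q.length = 3 * (p x.1 i).length ∧
          ∀ y ∈ q.support, y.1 ∈ (p x.1 i).support ∧ (y.1 = x.1 → y = x ∨ y.2 = Sum.inr i ∨
            ∃ w ∈ (p x.1 i).support, G.Adj x.1 w ∧ y.2 = Sum.inl (φ x.1 w)) := by
    intro x i
    by_cases hx : x ∈ degreeSet (blowUp (slotGraph G φ)) m
    · obtain ⟨v, a, rfl, hv, ha, -⟩ := mem_degreeSet_meredith hφ hmin hx
      obtain ⟨z', q, h1, h2, h3⟩ :=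
        exists_lift_path hφ i (p v i) ((hp v hv).1 i) a (fun w _ hw => ha w hw)
      exact ⟨z', q, fun _ => ⟨h1, h2, fun y hy => ⟨(h3 y hy).1, fun hyv =>
        ((h3 y hy).2 hyv).imp_left fun h => Prod.ext hyv h⟩⟩⟩
    · exact ⟨x, .nil, fun h => absurd h hx⟩
  choose z' q hq using this
  refine ⟨z', q, fun x hx => ?_⟩
  obtain ⟨v, a, hxv, hv, ha, huniq⟩ := mem_degreeSet_meredith hφ hmin hx
  have hx1 : x.1 = v := by rw [hxv]
  subst hx1
  obtain ⟨-, p2, p3, p4, p5⟩ := hp x.1 hv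
  refine ⟨fun i => (hq x i hx).1, fun i => ?_, ?_, ?_, ?_⟩
  · rw [(hq x i hx).2.1]
    exact Nat.mul_le_mul_left 3 (p2 i)
  · intro i y hy hyd
    obtain ⟨w, _, hyw, hw, -⟩ := mem_degreeSet_meredith hφ hmin hyd
    refine huniq y hyd (p3 i y.1 ((hq x i hx).2.2 y hy).1 ?_)
    rw [hyw]
    exact hw
  · intro i j hij y hy hy'
    obtain ⟨h1, h2⟩ := (hq x i hx).2.2 y hy
    obtain ⟨h3, h4⟩ := (hq x j hx).2.2 y hy'
    have hyx := p4 i j hij y.1 h1 h3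
    rcases h2 hyx with h | h | ⟨w, hw, hxw, h⟩
    · exact h
    · rcases h4 hyx with h' | h' | ⟨w', hw', hxw', h'⟩
      · exact h'
      · rw [h] at h'
        simp [hij] at h'
      · rw [h] at h'
        simp at h'
    · rcases h4 hyx with h' | h' | ⟨w', hw', hxw', h'⟩
      · exact h'
      · rw [h] at h'
        simp at h'
      · rw [h, Sum.inl.injEq] at h'
        obtain rfl := hφ _ hxw hxw' h'
        exact absurd (p4 i j hij w hw hw') hxw.ne'
  · intro w hw hwx i j y hy hy'
    obtain ⟨u, b, hwu, hu, -⟩ := mem_degreeSet_meredith hφ hmin hw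
    have hw1 : w.1 = u := by rw [hwu]
    subst hw1
    exact p5 w.1 hu (fun h => hwx (huniq w hw h)) i j y.1 ((hq x i hx).2.2 y hy).1
      ((hq w j hw).2.2 y hy').1

end Meredith

/-! ### Iterating the extension -/

open Classical in
theorem exists_critical_of_length {m : ℕ} (hm : 1 ≤ m) (s : ℕ) :
    ∃ (V : Type) (_ : Fintype V) (_ : Nonempty V) (G : SimpleGraph V),
      IsCritical (m + 1) G ∧ m ≤ G.minDegree ∧ HasLongPaths m s G ∧ s < Fintype.card V ∧
      Fintype.card V ≤ 2 * G.indepNum + 1 := by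
  have step : ∀ (V : Type) (_ : Fintype V) (_ : Nonempty V) (G : SimpleGraph V),
      IsCritical (m + 1) G → m ≤ G.minDegree →
      ∃ φ : V → V → Fin (m + 1), (∀ v, Set.InjOn (φ v) (G.neighborSet v)) ∧
        IsCritical (m + 1) (blowUp (slotGraph G φ)) ∧
        m ≤ (blowUp (slotGraph G φ)).minDegree ∧
        Fintype.card V < Fintype.card (V × (Fin (m + 1) ⊕ Fin m)) := by
    intro V _ _ G hG hmin
    obtain ⟨φ, hφ⟩ := exists_slots (G := G) (m := m) fun v => hG.1 ▸ G.degree_le_maxDegree v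
    refine ⟨φ, hφ, isCritical_meredith hm hφ hG fun v => ?_,
      le_minDegree_blowUp (slotGraph_matching hφ), ?_⟩
    · have h : 0 < G.degree v := lt_of_lt_of_le hm (hmin.trans (G.minDegree_le_degree v))
      exact (G.degree_pos_iff_exists_adj v).1 h
    · have : 0 < Fintype.card V := Fintype.card_pos
      simp only [Fintype.card_prod, Fintype.card_sum, Fintype.card_fin]
      nlinarith
  have hbase := isCritical_blowUp_slotEdge hm
  have hbase' : m ≤ (blowUp (slotEdge m)).minDegree := le_minDegree_blowUp slotEdge_matching
  -- The induction starts at length 1, since tripling length 0 gains nothing. The initial graph is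
  -- extended once so that each blob has at most one free slot.
  suffices ∃ (V : Type) (_ : Fintype V) (_ : Nonempty V) (G : SimpleGraph V),
      IsCritical (m + 1) G ∧ m ≤ G.minDegree ∧ HasLongPaths m (s + 1) G ∧ s < Fintype.card V ∧
      Fintype.card V ≤ 2 * G.indepNum + 1 by
    obtain ⟨V, i1, i2, G, h1, h2, ⟨z, p, hp⟩, h4⟩ := this
    exact ⟨V, i1, i2, G, h1, h2, ⟨z, p, fun v hv => ⟨(hp v hv).1,
      fun i => (Nat.le_succ s).trans ((hp v hv).2.1 i), (hp v hv).2.2⟩⟩, h4⟩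
  induction s with
  | zero =>
    obtain ⟨φ, hφ, h1, h2, h3⟩ := step _ inferInstance inferInstance _ hbase hbase'
    exact ⟨_, inferInstance, inferInstance, _, h1, h2, hasLongPaths_one_meredith hφ hbase',
      Fintype.card_pos, card_le_indepNum_blowUp (card_le_indepNum_blowUp_slotEdge m)⟩
  | succ s ih =>
    obtain ⟨V, i1, i2, G, h1, h2, h3, h4, h5⟩ := ih
    obtain ⟨φ, hφ, h6, h7, h8⟩ := step V i1 i2 G h1 h2
    obtain ⟨z, p, hp⟩ := h3.meredith hφ h2
    refine ⟨_, inferInstance, inferInstance, _, h6, h7, ⟨z, p, fun v hv => ⟨(hp v hv).1,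
      fun i => ?_, (hp v hv).2.2⟩⟩, by lia, card_le_indepNum_blowUp h5⟩
    have := (hp v hv).2.1 i
    lia

/-! ### Bounds for the independence ratio -/

open Classical in
theorem card_degreeSet_mul_le {V : Type*} [Fintype V] {m t : ℕ} (hm : 1 ≤ m) {G : SimpleGraph V}
    (h : HasDistinguishedPaths (m + 1) t G) :
    (Finset.univ.filter fun v => G.degree v = m).card * (t + 1) ≤ Fintype.card V := by
  obtain ⟨z, p, hp⟩ := h
  let i : Fin (m + 1 - 1) := ⟨0, by lia⟩
  let S : V → Finset V := fun v => (p v i).support.toFinset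
  have hS : ∀ v, walkVerts (p v i) = (S v : Set V) := fun v => by ext x; simp [walkVerts, S]
  have hmem : ∀ v ∈ Finset.univ.filter fun v => G.degree v = m, v ∈ degreeSet G (m + 1 - 1) :=
    fun v hv => by simpa [degreeSet] using hv
  rw [← smul_eq_mul]
  refine (Finset.card_nsmul_le_sum _ (fun v => (S v).card) _ fun v hv => ?_).trans ?_
  · have h1 := (hp v (hmem v hv)).2.2.1 i
    rw [hS, Set.ncard_coe_finset, Nat.add_sub_cancel] at h1
    -- Here `2 * t * m + 2 ≥ t + 1` because `m ≥ 1`.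
    nlinarith
  · rw [← Finset.card_biUnion]
    · exact Finset.card_le_univ _
    · intro v hv w hw hvw
      have h1 := (hp v (hmem v hv)).2.2.2.2 w (hmem w hw) hvw.symm i i
      rw [hS, hS] at h1
      rw [Function.onFun, Finset.disjoint_iff_inter_eq_empty]
      exact_mod_cast h1

open Classical in
-- Edges between an independent set `I` and its complement are counted twice: at least `(m + 1) *
-- |I|` minus the number of vertices of degree `m`, and at most `(m + 1) * |Iᶜ|`.
theorem indepNum_mul_le {V : Type*} [Fintype V] {m : ℕ} {G : SimpleGraph V}
    (hmax : G.maxDegree ≤ m + 1) (hmin : m ≤ G.minDegree) :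
    2 * (m + 1) * G.indepNum ≤ (m + 1) * Fintype.card V +
      (Finset.univ.filter fun v => G.degree v = m).card := by
  obtain ⟨I, hI, hcard⟩ := G.exists_isNIndepSet_indepNum
  rw [← hcard]
  have h1 : ∀ v ∈ I, G.degree v ≤ (Iᶜ.bipartiteAbove G.Adj v).card := by
    intro v hv
    rw [← SimpleGraph.card_neighborFinset_eq_degree]
    refine Finset.card_le_card fun w hw => ?_
    rw [SimpleGraph.mem_neighborFinset] at hw
    rw [Finset.mem_bipartiteAbove, Finset.mem_compl]
    exact ⟨fun hwI => hI hv hwI hw.ne hw, hw⟩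
  have h2 : ∀ w ∈ Iᶜ, (I.bipartiteBelow G.Adj w).card ≤ m + 1 := by
    intro w _
    refine le_trans ?_ ((G.degree_le_maxDegree w).trans hmax)
    rw [← SimpleGraph.card_neighborFinset_eq_degree]
    refine Finset.card_le_card fun v hv => ?_
    rw [Finset.mem_bipartiteBelow] at hv
    rw [SimpleGraph.mem_neighborFinset]
    exact hv.2.symm
  have h3 := (Finset.sum_le_sum h1).trans
    ((Finset.sum_card_bipartiteAbove_eq_sum_card_bipartiteBelow G.Adj).le.trans
      (Finset.sum_le_card_nsmul _ _ _ h2))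
  have h4 : I.card * (m + 1) ≤ ∑ v ∈ I, G.degree v +
      (Finset.univ.filter fun v => G.degree v = m).card := by
    have h5 : ∀ v ∈ I, m + 1 ≤ G.degree v + if G.degree v = m then 1 else 0 := by
      intro v _
      have := hmin.trans (G.minDegree_le_degree v)
      split_ifs with h <;> lia
    have h6 := Finset.card_nsmul_le_sum _ _ _ h5
    rw [Finset.sum_add_distrib, ← Finset.card_filter, smul_eq_mul] at h6
    exact h6.trans (Nat.add_le_add_left
      (Finset.card_le_card (Finset.filter_subset_filter _ (Finset.subset_univ I))) _)
  rw [Finset.card_compl, smul_eq_mul] at h3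
  obtain ⟨d, hd⟩ := Nat.exists_eq_add_of_le (Finset.card_le_univ I)
  rw [hd, Nat.add_sub_cancel_left] at h3
  rw [hd]
  nlinarith

theorem InClass.indepRatio_le {V : Type*} [Fintype V] {m t : ℕ} (hm : 1 ≤ m) {G : SimpleGraph V}
    (h : InClass (m + 1) t G) : indepRatio G ≤ 1 / 2 + 1 / ((t : ℝ) + 1) := by
  classical
  obtain ⟨hcrit, hmin, hpaths⟩ := h
  have h1 := indepNum_mul_le hcrit.1.le hmin
  have h2 := card_degreeSet_mul_le hm hpaths
  generalize (Finset.univ.filter fun v => G.degree v = m).card = d at h1 h2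
  have ht : (0 : ℝ) < (t : ℝ) + 1 := by positivity
  rw [indepRatio]
  refine div_le_of_le_mul₀ (by positivity) (by positivity) ?_
  have h1' : 2 * ((m : ℝ) + 1) * G.indepNum ≤ (m + 1) * Fintype.card V + d := by exact_mod_cast h1
  have h2' : (d : ℝ) ≤ Fintype.card V / (t + 1) := by
    rw [le_div_iff₀ ht]
    exact_mod_cast h2
  have h3 : (0 : ℝ) ≤ Fintype.card V / (t + 1) := by positivity
  rw [add_mul, one_div_mul_eq_div (t + 1 : ℝ)]
  generalize (Fintype.card V : ℝ) / (t + 1) = q at *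
  have hm' : (0 : ℝ) < (m : ℝ) + 1 := by positivity
  have h4 : ((m : ℝ) + 1) * G.indepNum ≤ (m + 1) * (1 / 2 * Fintype.card V + q) := by
    nlinarith [mul_nonneg (Nat.cast_nonneg (α := ℝ) m) h3]
  exact le_of_mul_le_mul_left h4 hm'

theorem exists_inClass {m : ℕ} (hm : 1 ≤ m) (t : ℕ) :
    ∃ (V : Type) (_ : Fintype V) (G : SimpleGraph V), InClass (m + 1) t G ∧
      1 / 2 - 1 / ((t : ℝ) + 1) ≤ indepRatio G := by
  classical
  obtain ⟨V, i, _, G, h1, h2, h3, h4, h5⟩ := exists_critical_of_length hm (2 * t * m + 1)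
  refine ⟨V, i, G, ⟨h1, h2, h3.hasDistinguishedPaths le_rfl⟩, ?_⟩
  have ht : (0 : ℝ) < (t : ℝ) + 1 := by positivity
  have hn : (t : ℝ) + 1 ≤ Fintype.card V := by
    have : t + 1 ≤ Fintype.card V := by nlinarith
    exact_mod_cast this
  have h5' : (Fintype.card V : ℝ) ≤ 2 * G.indepNum + 1 := by exact_mod_cast h5
  rw [indepRatio, le_div_iff₀ (ht.trans_le hn), sub_mul, one_div_mul_eq_div (t + 1 : ℝ)]
  have : 1 ≤ (Fintype.card V : ℝ) / (t + 1) := (one_le_div ht).2 hn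
  linarith

end CriticalGraph

theorem mainTheorem3 (k : ℕ) (hk : 2 ≤ k) :
    Tendsto (fun t : ℕ => CriticalGraph.iota k t) atTop (𝓝 (1 / 2 : ℝ)) := by
  obtain ⟨m, rfl⟩ : ∃ m, k = m + 1 := ⟨k - 1, by lia⟩
  have hm : 1 ≤ m := by lia
  have hlim := tendsto_one_div_add_atTop_nhds_zero_nat (𝕜 := ℝ)
  have hlow := (tendsto_const_nhds (x := (1 / 2 : ℝ))).sub hlim
  have hupp := (tendsto_const_nhds (x := (1 / 2 : ℝ))).add hlim
  rw [sub_zero] at hlow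
  rw [add_zero] at hupp
  refine tendsto_of_tendsto_of_tendsto_of_le_of_le hlow hupp ?_ ?_
  · intro t
    obtain ⟨V, i, G, hG, hr⟩ := CriticalGraph.exists_inClass hm t
    -- The real supremum needs boundedness here, and nonemptiness for the upper bound below.
    refine hr.trans (le_csSup ⟨1 / 2 + 1 / ((t : ℝ) + 1), ?_⟩ ⟨V, i, G, hG, rfl⟩)
    rintro r ⟨W, j, H, hH, rfl⟩
    exact hH.indepRatio_le hm
  · intro t
    refine csSup_le ?_ ?_
    · obtain ⟨V, i, G, hG, -⟩ := CriticalGraph.exists_inClass hm t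
      exact ⟨_, V, i, G, hG, rfl⟩
    · rintro r ⟨W, j, H, hH, rfl⟩
      exact hH.indepRatio_le hm
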